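/- Let $\mathsf k$ be a field, $S=\mathsf k[x_1,\dots,x_n]$, and let $I\subseteq S$ be an ideal minimally generated by $q$ square-free monomials. For a finitely generated $S$-module $M$ and $t\ge 0$, let $\beta_t(M)$ denote the $t$-th Betti number of $M$, that is, the smallest possible rank of the free module in position $t$ of a finite free resolution $0\to S^{\beta_N}\to\cdots\to S^{\beta_1}\to S^{\beta_0}\to M\to 0$ of $M$. For $r\ge 1$ let $b=b(r,q)$ be the coefficient of $x^r$ in the expansion of $$(1+x+x^2+\cdots+x^{\lceil r/2\rceil})^q .$$ Then for $r=2$ and $r=3$ and all $t\ge 0$, $$\beta_t(I^r)\;\le\; q\binom{q-1}{t}+\binom{b}{t+1}.$$ If $r=2$, then $b=\binom q2$, so that the bound becomes $$\beta_t(I^2)\;\le\; q\binom{q-1}{t}+\binom{\binom q2}{t+1}.$$ -/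

import Mathlib

/-- A finite free resolution
`0 → S^{β_N} → ⋯ → S^{β_1} → S^{β_0} → M → 0`
of a module `M` by free modules of finite rank, where `β_j = rank j`. -/
structure FreeResolution (S : Type*) [CommRing S] (M : Type*) [AddCommGroup M] [Module S M] where
  /-- the rank of the free module in homological position `j` -/
  rank : ℕ → ℕ
  /-- the differentials -/
  d : ∀ j : ℕ, (Fin (rank (j + 1)) → S) →ₗ[S] (Fin (rank j) → S)
  /-- the augmentation onto `M` -/
  aug : (Fin (rank 0) → S) →ₗ[S] M
  aug_surjective : Function.Surjective aug
  exact_aug : Function.Exact (d 0) aug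
  exact_d : ∀ j : ℕ, Function.Exact (d (j + 1)) (d j)
  /-- the resolution has finite length -/
  finite_length : ∃ N : ℕ, ∀ j : ℕ, N < j → rank j = 0

/-- The `t`-th Betti number of `M`: the smallest possible rank of the free module in position `t`
of a free resolution of `M`. The value is `⊤` if `M` has no finite free resolution. -/
noncomputable def bettiNumber (S : Type*) [CommRing S] (M : Type*) [AddCommGroup M] [Module S M]
    (t : ℕ) : ℕ∞ :=
  ⨅ F : FreeResolution S M, (F.rank t : ℕ∞)

/-- A square-free monomial: a product of distinct variables. -/
def IsSquarefreeMonomial {σ k : Type*} [CommSemiring k] (f : MvPolynomial σ k) : Prop :=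
  ∃ A : Finset σ, f = ∏ x ∈ A, MvPolynomial.X x

/-- The family `m` is a minimal generating family of the ideal `I`: it generates `I`, and
it no longer does so after the removal of any one of its members. -/
def IsMinimallyGeneratedBy {S ι : Type*} [CommRing S] (I : Ideal S) (m : ι → S) : Prop :=
  Ideal.span (Set.range m) = I ∧ ∀ i : ι, Ideal.span (m '' {j | j ≠ i}) ≠ I

/-- The coefficient of `x ^ r` in `(1 + x + x ^ 2 + ⋯ + x ^ ⌈r / 2⌉) ^ q`. -/
noncomputable def bCoeff (r q : ℕ) : ℕ :=
  ((∑ i ∈ Finset.range (⌈(r : ℚ) / 2⌉₊ + 1), (Polynomial.X : Polynomial ℕ) ^ i) ^ q).coeff r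

/-! A Betti number is an infimum over all finite free resolutions, so one resolution of `I ^ r` with
the stated ranks suffices; it need not be minimal. The generators of `I ^ r` split into mixed
products and pure powers `m_i ^ r`. Taylor's resolution handles the mixed ones and accounts for
`b.choose (t + 1)`. The pure powers are then adjoined one at a time by mapping cones
(`IsResolvedBy.sup_span_singleton`). By square-freeness, each colon ideal that occurs is generated
by the `q - 1` monomials `m_j / gcd(m_j, m_i)`, `j ≠ i` (`exists_sub_le_iff`), so Taylor's
resolution of it adds `(q - 1).choose t` in position `t`.

This works for every `r ≥ 2`. Only for `r = 2, 3` is `⌈r / 2⌉ = r - 1`, so that `b` counts exactly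
the mixed multisets. -/

open MvPolynomial

universe u

/-! ### Resolutions by iterated syzygies, horseshoe lemma, mapping cones -/

section Resolutions

variable {S : Type u} [CommRing S]

/-- `M` has a free resolution of length less than `N` whose free module in position `t` has
rank `f t`; the resolution is given by its successive syzygy modules. -/
def IsResolvedBy (S : Type u) [CommRing S] :
    ℕ → ∀ (M : Type u) [AddCommGroup M] [Module S M], (ℕ → ℕ) → Prop
  | 0, M, _, _, f => Subsingleton M ∧ ∀ t, f t = 0
  | N + 1, M, _, _, f => ∃ π : (Fin (f 0) → S) →ₗ[S] M, Function.Surjective π ∧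
      IsResolvedBy S N (LinearMap.ker π) fun t => f (t + 1)

theorem IsResolvedBy.congr_equiv {N : ℕ} {M M' : Type u} [AddCommGroup M] [Module S M]
    [AddCommGroup M'] [Module S M'] {f : ℕ → ℕ} (h : IsResolvedBy S N M f) (e : M ≃ₗ[S] M') :
    IsResolvedBy S N M' f := by
  cases N with
  | zero =>
    have := h.1
    exact ⟨e.symm.toEquiv.subsingleton, h.2⟩
  | succ N =>
    obtain ⟨π, hπ, hk⟩ := h
    refine ⟨e.toLinearMap ∘ₗ π, e.surjective.comp hπ, ?_⟩
    rw [LinearEquiv.ker_comp]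
    exact hk

theorem IsResolvedBy.of_surjective {N : ℕ} {M P : Type u} [AddCommGroup M] [Module S M]
    [AddCommGroup P] [Module S P] {f : ℕ → ℕ} (e : P ≃ₗ[S] (Fin (f 0) → S)) (π : P →ₗ[S] M)
    (hπ : Function.Surjective π)
    (h : IsResolvedBy S N (LinearMap.ker π) fun t => f (t + 1)) :
    IsResolvedBy S (N + 1) M f := by
  refine ⟨π ∘ₗ e.symm.toLinearMap, hπ.comp e.symm.surjective, h.congr_equiv ?_⟩
  refine e.ofSubmodules _ _ ?_
  ext x
  simp [LinearMap.mem_ker]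

theorem IsResolvedBy.succ {N : ℕ} {M : Type u} [AddCommGroup M] [Module S M] {f : ℕ → ℕ}
    (h : IsResolvedBy S N M f) : IsResolvedBy S (N + 1) M f := by
  induction N generalizing M f with
  | zero =>
    obtain ⟨hM, hf⟩ := h
    refine ⟨0, fun x => ⟨0, Subsingleton.elim _ _⟩, ?_, fun t => hf _⟩
    have : IsEmpty (Fin (f 0)) := by rw [hf 0]; infer_instance
    infer_instance
  | succ N ih =>
    obtain ⟨π, hπ, hk⟩ := h
    exact ⟨π, hπ, ih hk⟩

theorem IsResolvedBy.mono {N N' : ℕ} (hN : N ≤ N') {M : Type u} [AddCommGroup M] [Module S M]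
    {f : ℕ → ℕ} (h : IsResolvedBy S N M f) : IsResolvedBy S N' M f := by
  induction hN with
  | refl => exact h
  | step _ ih => exact ih.succ

/-- The product of two free modules of finite rank is free of the sum of the ranks. -/
def finArrowProdEquiv (S : Type u) [CommRing S] (a c : ℕ) :
    ((Fin a → S) × (Fin c → S)) ≃ₗ[S] (Fin (a + c) → S) :=
  (LinearEquiv.sumArrowLequivProdArrow (Fin a) (Fin c) S S).symm ≪≫ₗ
    LinearEquiv.funCongrLeft S S finSumFinEquiv.symm

/-- The horseshoe lemma. -/
theorem IsResolvedBy.of_exact {N : ℕ} {A B C : Type u} [AddCommGroup A] [Module S A]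
    [AddCommGroup B] [Module S B] [AddCommGroup C] [Module S C] {a c : ℕ → ℕ}
    (i : A →ₗ[S] B) (p : B →ₗ[S] C) (hi : Function.Injective i) (hp : Function.Surjective p)
    (hip : Function.Exact i p) (hA : IsResolvedBy S N A a) (hC : IsResolvedBy S N C c) :
    IsResolvedBy S N B fun t => a t + c t := by
  induction N generalizing A B C a c with
  | zero =>
    obtain ⟨hA, ha⟩ := hA
    obtain ⟨hC, hc⟩ := hC
    refine ⟨⟨fun x y => ?_⟩, fun t => by simp [ha, hc]⟩
    obtain ⟨z, hz⟩ := (hip (x - y)).1 (Subsingleton.elim _ _)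
    rw [Subsingleton.elim z 0, map_zero] at hz
    exact sub_eq_zero.1 hz.symm
  | succ N ih =>
    obtain ⟨α, hα, hkα⟩ := hA
    obtain ⟨γ, hγ, hkγ⟩ := hC
    obtain ⟨l, hl⟩ := Module.projective_lifting_property p γ hp
    have hl' : ∀ y, p (l y) = γ y := fun y => LinearMap.congr_fun hl y
    have hpi : ∀ x, p (i x) = 0 := fun x => (hip _).2 ⟨x, rfl⟩
    let β : ((Fin (a 0) → S) × (Fin (c 0) → S)) →ₗ[S] B := (i ∘ₗ α).coprod l
    have hβ : ∀ x, β x = i (α x.1) + l x.2 := fun x => by simp [β]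
    refine IsResolvedBy.of_surjective (f := fun t => a t + c t) (finArrowProdEquiv S _ _) β ?_ ?_
    · intro b
      obtain ⟨y, hy⟩ := hγ (p b)
      obtain ⟨z, hz⟩ := (hip (b - l y)).1 (by rw [map_sub, hl', hy, sub_self])
      obtain ⟨x, rfl⟩ := hα z
      exact ⟨(x, y), by rw [hβ, hz, sub_add_cancel]⟩
    -- The syzygy modules form a short exact sequence again, so the induction applies to them.
    · let i' : LinearMap.ker α →ₗ[S] LinearMap.ker β :=
        (LinearMap.inl S _ _ ∘ₗ (LinearMap.ker α).subtype).codRestrict _ fun x => by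
          simp [LinearMap.mem_ker, hβ]
      let p' : LinearMap.ker β →ₗ[S] LinearMap.ker γ :=
        (LinearMap.snd S _ _ ∘ₗ (LinearMap.ker β).subtype).codRestrict _ fun x => by
          have h := x.2
          rw [LinearMap.mem_ker, hβ] at h
          have h2 := congrArg p h
          rw [map_add, hpi, hl', zero_add, map_zero] at h2
          exact h2
      refine ih i' p' ?_ ?_ ?_ hkα hkγ
      · intro x y hxy
        have := congrArg (fun z => z.1.1) hxy
        exact Subtype.ext this
      · rintro ⟨y, hy⟩
        obtain ⟨z, hz⟩ := (hip (-l y)).1 (by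
          rw [map_neg, hl', LinearMap.mem_ker.1 hy, neg_zero])
        obtain ⟨x, rfl⟩ := hα z
        refine ⟨⟨(x, y), ?_⟩, rfl⟩
        rw [LinearMap.mem_ker, hβ, hz, neg_add_cancel]
      · rintro ⟨⟨x, y⟩, hxy⟩
        constructor
        · intro h
          obtain rfl : y = 0 := congrArg Subtype.val h
          rw [LinearMap.mem_ker, hβ, map_zero, add_zero] at hxy
          exact ⟨⟨x, hi (by rw [hxy, map_zero])⟩, rfl⟩
        · rintro ⟨z, hz⟩
          rw [← hz]
          rfl

/-- The ranks of the iterated mapping cone: adding one generator to an ideal resolved with ranks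
`a`, the colon ideal being resolved with ranks `c`. -/
def addGeneratorRank (a c : ℕ → ℕ) : ℕ → ℕ
  | 0 => a 0 + 1
  | t + 1 => a (t + 1) + c t

/-- Here `K` is the colon ideal `J : g`. Covering `J + (g)` by a cover of `J` plus one free
generator, the coefficient of `g` in a relation ranges exactly over `K`; hence the syzygies are an
extension of `K` by those of `J`, and the horseshoe lemma applies. -/
theorem IsResolvedBy.sup_span_singleton {N : ℕ} {J K : Ideal S} {g : S}
    (hK : ∀ s, s ∈ K ↔ s * g ∈ J) {a c : ℕ → ℕ} (hJ : IsResolvedBy S (N + 1) J a)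
    (hc : IsResolvedBy S N K c) :
    IsResolvedBy S (N + 1) (J ⊔ Ideal.span {g} : Ideal S) (addGeneratorRank a c) := by
  obtain ⟨α, hα, hkα⟩ := hJ
  let β : ((Fin (a 0) → S) × (Fin 1 → S)) →ₗ[S] (J ⊔ Ideal.span {g} : Ideal S) :=
    ((J.subtype ∘ₗ α).coprod (LinearMap.toSpanSingleton S S g ∘ₗ LinearMap.proj 0)).codRestrict _
      fun x => by
        simp only [LinearMap.coprod_apply, LinearMap.comp_apply, Submodule.subtype_apply,
          LinearMap.proj_apply, LinearMap.toSpanSingleton_apply, smul_eq_mul]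
        exact Submodule.add_mem_sup (α x.1).2
          (Ideal.mul_mem_left _ _ (Ideal.mem_span_singleton_self g))
  have hβ : ∀ x, (β x : S) = α x.1 + x.2 0 * g := fun x => by simp [β]
  have hker : ∀ x, x ∈ LinearMap.ker β ↔ (α x.1 : S) + x.2 0 * g = 0 := fun x => by
    rw [LinearMap.mem_ker, ← hβ, Submodule.coe_eq_zero]
  refine IsResolvedBy.of_surjective (f := addGeneratorRank a c) (finArrowProdEquiv S _ _) β ?_ ?_
  · rintro ⟨b, hb⟩
    obtain ⟨y, hy, z, hz, rfl⟩ := Submodule.mem_sup.1 hb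
    obtain ⟨s, rfl⟩ := Ideal.mem_span_singleton'.1 hz
    obtain ⟨x, hx⟩ := hα ⟨y, hy⟩
    exact ⟨(x, fun _ => s), Subtype.ext (by rw [hβ, hx])⟩
  · let i' : LinearMap.ker α →ₗ[S] LinearMap.ker β :=
      (LinearMap.inl S _ _ ∘ₗ (LinearMap.ker α).subtype).codRestrict _ fun x => by
        rw [hker]
        simp
    let p' : LinearMap.ker β →ₗ[S] K :=
      (LinearMap.proj 0 ∘ₗ LinearMap.snd S _ (Fin 1 → S) ∘ₗ
        (LinearMap.ker β).subtype).codRestrict _ fun x => by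
          have h := (hker _).1 x.2
          rw [hK]
          rw [add_comm] at h
          change x.1.2 0 * g ∈ J
          rw [eq_neg_of_add_eq_zero_left h]
          exact J.neg_mem (α _).2
    refine IsResolvedBy.of_exact i' p' ?_ ?_ ?_ hkα hc
    · intro x y hxy
      have := congrArg (fun z => z.1.1) hxy
      exact Subtype.ext this
    · rintro ⟨s, hs⟩
      obtain ⟨x, hx⟩ := hα (-⟨s * g, (hK s).1 hs⟩)
      refine ⟨⟨(x, fun _ => s), ?_⟩, rfl⟩
      rw [hker, hx]
      simp
    · rintro ⟨⟨x, y⟩, hxy⟩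
      constructor
      · intro h
        have hy0 : y 0 = 0 := congrArg Subtype.val h
        obtain rfl : y = 0 := by
          ext j
          rw [Subsingleton.elim j 0, hy0]
          rfl
        have := (hker _).1 hxy
        simp only [Pi.zero_apply, zero_mul, add_zero, Submodule.coe_eq_zero] at this
        exact ⟨⟨x, this⟩, rfl⟩
      · rintro ⟨z, hz⟩
        rw [← hz]
        rfl

theorem IsResolvedBy.exists_freeResolution {N : ℕ} {M : Type u} [AddCommGroup M] [Module S M]
    {f : ℕ → ℕ} (h : IsResolvedBy S N M f) : ∃ F : FreeResolution S M, F.rank = f := by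
  induction N generalizing M f with
  | zero =>
    obtain ⟨hM, hf⟩ := h
    obtain rfl : f = fun _ => 0 := funext hf
    refine ⟨⟨fun _ => 0, fun _ => 0, 0, fun x => ⟨0, Subsingleton.elim _ _⟩, ?_, fun j => ?_,
      0, fun _ _ => rfl⟩, rfl⟩
    · exact fun x => ⟨fun _ => ⟨0, Subsingleton.elim _ _⟩, fun _ => Subsingleton.elim _ _⟩
    · exact fun x => ⟨fun _ => ⟨0, Subsingleton.elim _ _⟩, fun _ => Subsingleton.elim _ _⟩
  | succ N ih =>
    obtain ⟨π, hπ, hk⟩ := h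
    obtain ⟨F, hF⟩ := ih hk
    have hFr : ∀ t, F.rank t = f (t + 1) := congrFun hF
    refine ⟨⟨fun t => Nat.casesOn t (f 0) F.rank, fun j => match j with
        | 0 => (LinearMap.ker π).subtype ∘ₗ F.aug
        | j + 1 => F.d j, π, hπ, ?_, fun j => ?_, ?_⟩, ?_⟩
    · intro x
      constructor
      · intro hx
        obtain ⟨y, hy⟩ := F.aug_surjective ⟨x, hx⟩
        exact ⟨y, by simp [hy]⟩
      · rintro ⟨y, rfl⟩
        exact (F.aug y).2
    · cases j with
      | zero =>
        intro x
        rw [← F.exact_aug x]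
        exact Submodule.coe_eq_zero
      | succ j => exact F.exact_d j
    · obtain ⟨L, hL⟩ := F.finite_length
      refine ⟨L + 1, fun j hj => ?_⟩
      cases j with
      | zero => omega
      | succ j => exact hL j (by omega)
    · ext t
      cases t with
      | zero => rfl
      | succ t => exact hFr t

theorem IsResolvedBy.bettiNumber_le {N : ℕ} {M : Type u} [AddCommGroup M] [Module S M]
    {f : ℕ → ℕ} (h : IsResolvedBy S N M f) (t : ℕ) : bettiNumber S M t ≤ (f t : ℕ∞) := by
  obtain ⟨F, rfl⟩ := h.exists_freeResolution
  exact iInf_le _ F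

end Resolutions

/-! ### Monomial ideals, Taylor's resolution, powers -/

section MonomialIdeals

variable {σ : Type} {k : Type u} [Field k]

/-- The ideal generated by the monomials with exponent vectors in `A`. -/
noncomputable def monomialIdeal (k : Type u) [Field k] (A : Set (σ →₀ ℕ)) :
    Ideal (MvPolynomial σ k) :=
  Ideal.span ((fun s => monomial s (1 : k)) '' A)

theorem monomialIdeal_insert (e : σ →₀ ℕ) (A : Set (σ →₀ ℕ)) :
    monomialIdeal k (insert e A) = monomialIdeal k A ⊔ Ideal.span {monomial e 1} := by
  rw [monomialIdeal, Set.image_insert_eq, Ideal.span_insert, sup_comm, monomialIdeal]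

/-- `B` generates the colon ideal of `A` by the monomial `e` as soon as this holds at the level of
monomials. -/
theorem mem_monomialIdeal_iff_mul_mem {A B : Set (σ →₀ ℕ)} {e : σ →₀ ℕ}
    (h : ∀ x, (∃ b ∈ B, b ≤ x) ↔ ∃ a ∈ A, a ≤ x + e) (s : MvPolynomial σ k) :
    s ∈ monomialIdeal k B ↔ s * monomial e 1 ∈ monomialIdeal k A := by
  rw [monomialIdeal, monomialIdeal, mem_ideal_span_monomial_image, mem_ideal_span_monomial_image]
  simp only [mem_support_iff, h]
  constructor
  · intro hs x hx
    rw [coeff_mul_monomial'] at hx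
    split_ifs at hx with hex
    · obtain ⟨a, ha, hax⟩ := hs (x - e) (by simpa using hx)
      exact ⟨a, ha, by rwa [tsub_add_cancel_of_le hex] at hax⟩
    · exact absurd rfl hx
  · intro hs x hx
    exact hs (x + e) (by simpa [coeff_mul_monomial] using hx)

/-- Taylor's resolution: an ideal generated by `s` monomials has a free resolution whose module in
position `t` has rank `s.choose (t + 1)`. -/
theorem isResolvedBy_taylor {ι : Type*} [DecidableEq ι] (T : Finset ι) (a : ι → σ →₀ ℕ) :
    ∃ N, IsResolvedBy (MvPolynomial σ k) N (monomialIdeal k (a '' T))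
      fun t => T.card.choose (t + 1) := by
  induction T using Finset.induction_on generalizing a with
  | empty =>
    refine ⟨0, ?_, fun t => rfl⟩
    rw [Finset.coe_empty, Set.image_empty, monomialIdeal, Set.image_empty, Ideal.span_empty]
    infer_instance
  | insert i T hi ih =>
    obtain ⟨N₁, h₁⟩ := ih a
    -- Truncated subtraction gives the exponents of `m_j / gcd(m_j, m_i)`, which generate the colon
    -- ideal; the ranks then add up by Pascal's rule.
    obtain ⟨N₂, h₂⟩ := ih fun j => a j - a i
    refine ⟨max N₁ N₂ + 1, ?_⟩
    rw [Finset.coe_insert, Set.image_insert_eq, monomialIdeal_insert]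
    convert IsResolvedBy.sup_span_singleton (N := max N₁ N₂)
      (mem_monomialIdeal_iff_mul_mem (k := k) (e := a i) ?_) (h₁.mono (by omega))
      (h₂.mono (by omega)) using 1
    · ext t
      rw [Finset.card_insert_of_notMem hi]
      cases t with
      | zero => simp [addGeneratorRank]
      | succ t => rw [addGeneratorRank, Nat.choose_succ_succ' T.card (t + 1), add_comm]
    · intro x
      simp

/-- The exponent vector of the product of the monomials with exponents `c i`, `i ∈ s`. -/
noncomputable def symExponent {ι : Type*} {r : ℕ} (c : ι → σ →₀ ℕ) (s : Sym ι r) : σ →₀ ℕ :=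
  ((s : Multiset ι).map c).sum

theorem symExponent_cons {ι : Type*} {r : ℕ} (c : ι → σ →₀ ℕ) (i : ι) (s : Sym ι r) :
    symExponent c (i ::ₛ s) = c i + symExponent c s := by
  rw [symExponent, Sym.coe_cons, Multiset.map_cons, Multiset.sum_cons, symExponent]

theorem symExponent_replicate {ι : Type*} (c : ι → σ →₀ ℕ) (r : ℕ) (i : ι) :
    symExponent c (Sym.replicate r i) = r • c i := by
  rw [symExponent, Sym.coe_replicate, Multiset.map_replicate, Multiset.sum_replicate]

theorem monomialIdeal_range_pow {ι : Type*} (c : ι → σ →₀ ℕ) (r : ℕ) :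
    monomialIdeal k (Set.range c) ^ r =
      monomialIdeal k (Set.range fun s : Sym ι r => symExponent c s) := by
  induction r with
  | zero =>
    have h : (Set.range fun s : Sym ι 0 => symExponent c s) = {0} := by
      rw [Set.range_eq_singleton_iff]
      intro s
      rw [Subsingleton.elim s Sym.nil, symExponent, Sym.coe_nil, Multiset.map_zero,
        Multiset.sum_zero]
    rw [pow_zero, h, monomialIdeal, Set.image_singleton, Ideal.one_eq_top]
    exact Ideal.span_singleton_one.symm
  | succ r ih =>
    rw [pow_succ', ih, monomialIdeal, monomialIdeal, monomialIdeal, Ideal.span_mul_span']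
    congr 1
    ext p
    simp only [Set.mem_mul, Set.mem_image, Set.mem_range, exists_exists_eq_and]
    constructor
    · rintro ⟨i, s, rfl⟩
      exact ⟨i ::ₛ s, by simp [symExponent_cons, monomial_mul]⟩
    · rintro ⟨s, rfl⟩
      obtain ⟨i, s, rfl⟩ := s.exists_eq_cons_of_succ
      exact ⟨i, s, by simp [symExponent_cons, monomial_mul]⟩

theorem le_symExponent {ι : Type*} {r : ℕ} (c : ι → σ →₀ ℕ) {s : Sym ι r} {i : ι} (hi : i ∈ s) :
    c i ≤ symExponent c s :=
  Multiset.single_le_sum (fun _ _ => zero_le) _ (Multiset.mem_map_of_mem c hi)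

section Powers

variable {ι : Type*} [Fintype ι] [DecidableEq ι]

/-- The multisets of size `r` that are not of the form `{i, …, i}`. -/
def mixedSym (ι : Type*) [Fintype ι] [DecidableEq ι] (r : ℕ) : Finset (Sym ι r) :=
  Finset.univ \ Finset.univ.image (Sym.replicate r)

theorem card_mixedSym {r : ℕ} (hr : r ≠ 0) :
    (mixedSym ι r).card + Fintype.card ι = (Fintype.card ι).multichoose r := by
  have h : (Finset.univ.image (Sym.replicate (α := ι) r)).card = Fintype.card ι :=
    Finset.card_image_of_injective _ (Sym.replicate_right_injective hr)
  rw [mixedSym, ← Sym.card_sym_eq_multichoose, ← Finset.card_univ (α := Sym ι r), ← h]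
  exact Finset.card_sdiff_add_card_eq_card (Finset.subset_univ _)

theorem exists_mem_ne_of_mem_mixedSym {r : ℕ} {s : Sym ι r} (hs : s ∈ mixedSym ι r) (i : ι) :
    ∃ j ∈ s, j ≠ i := by
  by_contra! h
  simp only [mixedSym, Finset.mem_sdiff, Finset.mem_univ, Finset.mem_image, true_and,
    not_exists] at hs
  exact hs i (Sym.eq_replicate.2 h).symm

theorem cons_replicate_mem_mixedSym {r : ℕ} (hr : r ≠ 0) {i j : ι} (hij : j ≠ i) :
    j ::ₛ Sym.replicate r i ∈ mixedSym ι (r + 1) := by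
  simp only [mixedSym, Finset.mem_sdiff, Finset.mem_univ, Finset.mem_image, true_and, not_exists]
  intro l h
  have hj : j ∈ Sym.replicate (r + 1) l := h ▸ Sym.mem_cons_self _ _
  have hi : i ∈ Sym.replicate (r + 1) l :=
    h ▸ Sym.mem_cons_of_mem (by simp [← Sym.mem_coe, Sym.coe_replicate, Multiset.mem_replicate, hr])
  simp only [← Sym.mem_coe, Sym.coe_replicate, Multiset.mem_replicate] at hi hj
  exact hij (hj.2.trans hi.2.symm)

/-- The colon ideal of the mixed products and some pure powers by a further pure power of a
square-free monomial, on the level of exponents. -/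
theorem exists_sub_le_iff {c : ι → σ →₀ ℕ} (hc : ∀ i y, c i y ≤ 1) {r : ℕ} (hr : 2 ≤ r)
    {T : Finset ι} {i : ι} (hi : i ∉ T) (x : σ →₀ ℕ) :
    (∃ b ∈ (fun j => c j - c i) '' (Finset.univ.erase i : Finset ι), b ≤ x) ↔
      ∃ a ∈ (symExponent c '' (mixedSym ι r : Set (Sym ι r))) ∪ (fun j => r • c j) '' T, a ≤ x + r • c i := by
  constructor
  · rintro ⟨_, ⟨j, hj, rfl⟩, hjx⟩
    obtain ⟨r, rfl⟩ : ∃ l, r = l + 1 := ⟨r - 1, by omega⟩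
    -- The witness is the mixed product `m_j * m_i ^ (r - 1)`.
    refine ⟨_, Or.inl ⟨_, cons_replicate_mem_mixedSym (by omega) (Finset.ne_of_mem_erase hj), rfl⟩,
      ?_⟩
    have h : symExponent c (j ::ₛ Sym.replicate r i) = c j + r • c i := by
      rw [symExponent_cons, symExponent_replicate]
    rw [h, succ_nsmul', ← add_assoc]
    gcongr
    exact tsub_le_iff_right.1 hjx
  -- Every generator other than `m_i ^ r` is divisible by some `m_j` with `j ≠ i`, and this
  -- divisibility is all that is needed.
  · have key : ∀ j, j ≠ i → ∀ a : σ →₀ ℕ, c j ≤ a → a ≤ x + r • c i →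
        ∃ b ∈ (fun j => c j - c i) '' (Finset.univ.erase i : Finset ι), b ≤ x := by
      intro j hj a hja hax
      refine ⟨_, ⟨j, by simpa using hj, rfl⟩, fun y => ?_⟩
      have h1 := (hja.trans hax) y
      have h2 := hc j y
      have h3 := hc i y
      simp only [Finsupp.coe_tsub, Finsupp.coe_add, Finsupp.coe_smul, Pi.sub_apply, Pi.add_apply,
        Pi.smul_apply, smul_eq_mul] at h1 ⊢
      -- Square-freeness: where `c i y = 1`, `c j - c i` vanishes; where `c i y = 0`, the term `r •
      -- c i` does not help.
      interval_cases c i y <;> omega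
    rintro ⟨a, ⟨s, hs, rfl⟩ | ⟨j, hj, rfl⟩, hax⟩
    · obtain ⟨j, hjs, hji⟩ := exists_mem_ne_of_mem_mixedSym hs i
      exact key j hji _ (le_symExponent c hjs) hax
    · exact key j (fun h => hi (h ▸ hj)) _ (le_self_nsmul zero_le (by omega)) hax

theorem isResolvedBy_mixed_union_pure {c : ι → σ →₀ ℕ} (hc : ∀ i y, c i y ≤ 1) {r : ℕ}
    (hr : 2 ≤ r) (T : Finset ι) :
    ∃ N, IsResolvedBy (MvPolynomial σ k) N
      (monomialIdeal k ((symExponent c '' (mixedSym ι r : Set (Sym ι r))) ∪ (fun j => r • c j) '' T))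
      fun t => T.card * (Fintype.card ι - 1).choose t + (mixedSym ι r).card.choose (t + 1) := by
  induction T using Finset.induction_on with
  | empty =>
    rw [Finset.coe_empty, Set.image_empty, Set.union_empty]
    simpa using isResolvedBy_taylor (k := k) (mixedSym ι r) (symExponent c)
  | insert i T hi ih =>
    obtain ⟨N₁, h₁⟩ := ih
    obtain ⟨N₂, h₂⟩ := isResolvedBy_taylor (k := k) (Finset.univ.erase i) fun j => c j - c i
    refine ⟨max N₁ N₂ + 1, ?_⟩
    rw [Finset.coe_insert, Set.image_insert_eq, Set.union_insert, monomialIdeal_insert]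
    convert IsResolvedBy.sup_span_singleton (N := max N₁ N₂)
      (mem_monomialIdeal_iff_mul_mem (k := k) (exists_sub_le_iff hc hr hi)) (h₁.mono (by omega))
      (h₂.mono (by omega)) using 1
    ext t
    rw [Finset.card_insert_of_notMem hi, Finset.card_erase_of_mem (Finset.mem_univ i),
      Finset.card_univ]
    cases t <;> simp only [addGeneratorRank, Nat.choose_zero_right] <;> ring

theorem isResolvedBy_pow {c : ι → σ →₀ ℕ} (hc : ∀ i y, c i y ≤ 1) {r : ℕ} (hr : 2 ≤ r) :
    ∃ N, IsResolvedBy (MvPolynomial σ k) N ↥(monomialIdeal k (Set.range c) ^ r) fun t =>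
      Fintype.card ι * (Fintype.card ι - 1).choose t + (mixedSym ι r).card.choose (t + 1) := by
  have h := isResolvedBy_mixed_union_pure (k := k) hc hr Finset.univ
  have hU : (symExponent c '' (mixedSym ι r : Set (Sym ι r))) ∪ (fun j => r • c j) '' (Finset.univ : Finset ι) =
      Set.range fun s : Sym ι r => symExponent c s := by
    have hp : (fun j => r • c j) = symExponent c ∘ Sym.replicate r :=
      funext fun j => (symExponent_replicate c r j).symm
    rw [hp, Set.image_comp, ← Set.image_union, ← Set.image_univ, mixedSym]
    simp
  rw [monomialIdeal_range_pow, ← hU]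
  exact h

end Powers

end MonomialIdeals

/-! ### The coefficient `b` for `r = 2` and `r = 3` -/

section Coefficients

open Polynomial in
theorem coeff_sum_range_X_pow_pow_succ (d q r : ℕ) :
    ((∑ i ∈ Finset.range d, (X : ℕ[X]) ^ i) ^ (q + 1)).coeff r =
      ∑ i ∈ Finset.range d, if i ≤ r then
        ((∑ i ∈ Finset.range d, (X : ℕ[X]) ^ i) ^ q).coeff (r - i) else 0 := by
  rw [pow_succ, Finset.mul_sum, finsetSum_coeff]
  simp_rw [coeff_mul_X_pow']

theorem bCoeff_two (q : ℕ) : bCoeff 2 q = q.choose 2 := by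
  have hd : ⌈((2 : ℕ) : ℚ) / 2⌉₊ + 1 = 2 := by norm_num
  rw [bCoeff, hd]
  have h (q : ℕ) : ∀ r, ((∑ i ∈ Finset.range 2, (Polynomial.X : Polynomial ℕ) ^ i) ^ q).coeff r =
      q.choose r := by
    intro r
    rw [Finset.sum_range_succ, Finset.sum_range_one, pow_zero, pow_one,
      Polynomial.coeff_one_add_X_pow, Nat.cast_id]
  exact h q 2

/-- Bounding exponents by `2` excludes from the degree `3` monomials in `q` variables just the `q`
cubes. Below degree `3` the bound excludes nothing, so those coefficients are full multiset counts.
-/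
theorem bCoeff_three_add (q : ℕ) : bCoeff 3 q + q = q.multichoose 3 := by
  have hd : ⌈((3 : ℕ) : ℚ) / 2⌉₊ + 1 = 3 := by
    have : ⌈((3 : ℕ) : ℚ) / 2⌉₊ = 2 := by
      rw [Nat.ceil_eq_iff two_ne_zero]
      norm_num
    rw [this]
  rw [bCoeff, hd]
  generalize hp : (∑ i ∈ Finset.range 3, (Polynomial.X : Polynomial ℕ) ^ i) = p
  have step (q r : ℕ) := coeff_sum_range_X_pow_pow_succ 3 q r
  simp only [hp] at step
  have h0 (q : ℕ) : (p ^ q).coeff 0 = 1 := by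
    induction q with
    | zero => simp
    | succ q ih => simp [step, ih]
  have h1 (q : ℕ) : (p ^ q).coeff 1 = q := by
    induction q with
    | zero => simp [Polynomial.coeff_one]
    | succ q ih => simp [step, Finset.sum_range_succ, ih, h0]
  have h2 (q : ℕ) : (p ^ q).coeff 2 = q.multichoose 2 := by
    induction q with
    | zero => simp [Polynomial.coeff_one]
    | succ q ih => simp [step, Finset.sum_range_succ, ih, h0, h1, Nat.multichoose_succ_succ]; ring
  induction q with
  | zero => simp [Polynomial.coeff_one]
  | succ q ih =>
    have e1 : (q + 1).multichoose 3 = q.multichoose 3 + (q + 1).multichoose 2 :=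
      Nat.multichoose_succ_succ q 2
    have e2 : (q + 1).multichoose 2 = q.multichoose 2 + (q + 1).multichoose 1 :=
      Nat.multichoose_succ_succ q 1
    rw [Nat.multichoose_one_right] at e2
    simp [step, Finset.sum_range_succ, h1, h2]
    omega

theorem card_mixedSym_eq_bCoeff {r q : ℕ} (hr : r = 2 ∨ r = 3) :
    (mixedSym (Fin q) r).card = bCoeff r q := by
  have h := card_mixedSym (ι := Fin q) (r := r) (by omega)
  rw [Fintype.card_fin] at h
  rcases hr with rfl | rfl
  · have h2 : q.multichoose 2 = q.choose 2 + q := by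
      rw [Nat.multichoose_eq, Nat.add_succ_sub_one, Nat.choose_succ_succ', Nat.choose_one_right,
        add_comm]
    rw [bCoeff_two]
    omega
  · have := bCoeff_three_add q
    omega

end Coefficients

/-! ### From square-free monomials to exponent vectors; the bounds -/

theorem exists_exponents_of_isSquarefreeMonomial {σ : Type} {ι k : Type*} [Field k]
    {m : ι → MvPolynomial σ k} (hm : ∀ i, IsSquarefreeMonomial (m i)) :
    ∃ c : ι → σ →₀ ℕ, (∀ i y, c i y ≤ 1) ∧ ∀ i, m i = monomial (c i) 1 := by
  classical
  choose A hA using hm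
  refine ⟨fun i => ∑ x ∈ A i, Finsupp.single x 1, fun i y => ?_, fun i => ?_⟩
  · simp only [Finsupp.coe_finsetSum, Finset.sum_apply, Finsupp.single_apply,
      Finset.sum_ite_eq']
    split_ifs <;> simp
  · rw [hA, monomial_sum_one]
    rfl

theorem bettiNumber_pow_le {k : Type*} [Field k] {n q : ℕ}
    (I : Ideal (MvPolynomial (Fin n) k)) (m : Fin q → MvPolynomial (Fin n) k)
    (hm : ∀ i, IsSquarefreeMonomial (m i)) (hI : Ideal.span (Set.range m) = I) {r : ℕ}
    (hr : r = 2 ∨ r = 3) (t : ℕ) :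
    bettiNumber (MvPolynomial (Fin n) k) ↥(I ^ r) t ≤
      ((q * (q - 1).choose t + (bCoeff r q).choose (t + 1) : ℕ) : ℕ∞) := by
  obtain ⟨c, hc, hmc⟩ := exists_exponents_of_isSquarefreeMonomial hm
  have hIc : I = monomialIdeal k (Set.range c) := by
    rw [← hI, monomialIdeal, ← Set.range_comp, funext hmc]
    rfl
  obtain ⟨N, h⟩ := isResolvedBy_pow (k := k) hc (r := r) (by omega)
  rw [card_mixedSym_eq_bCoeff hr, Fintype.card_fin, ← hIc] at h
  exact h.bettiNumber_le t

theorem corollary6p2 {k : Type*} [Field k] {n q : ℕ}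
    (I : Ideal (MvPolynomial (Fin n) k)) (m : Fin q → MvPolynomial (Fin n) k)
    (hm : ∀ i, IsSquarefreeMonomial (m i)) (hI : IsMinimallyGeneratedBy I m) :
    (∀ r : ℕ, r = 2 ∨ r = 3 → ∀ t : ℕ,
      bettiNumber (MvPolynomial (Fin n) k) ↥(I ^ r) t ≤
        ((q * (q - 1).choose t + (bCoeff r q).choose (t + 1) : ℕ) : ℕ∞)) ∧
    bCoeff 2 q = q.choose 2 ∧
    (∀ t : ℕ,
      bettiNumber (MvPolynomial (Fin n) k) ↥(I ^ 2) t ≤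
        ((q * (q - 1).choose t + (q.choose 2).choose (t + 1) : ℕ) : ℕ∞)) := by
  refine ⟨fun r hr t => bettiNumber_pow_le I m hm hI.1 hr t, bCoeff_two q, fun t => ?_⟩
  have h := bettiNumber_pow_le I m hm hI.1 (Or.inl rfl) t
  rwa [bCoeff_two] at h
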